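/- Let $n\ge 1$, and let $\mathbb S(2n)$ be the space of real symmetric $2n\times 2n$ matrices with inner product $\langle X,Y\rangle=\operatorname{tr}(XY)$, and $\mathbb P(2n)\subset\mathbb S(2n)$ the set of positive definite ones. Put $J=\begin{pmatrix}0&I_n\\-I_n&0\end{pmatrix}$. For $A\in\mathbb P(2n)$ let $d_1(A)\le\dots\le d_n(A)$ be its symplectic eigenvalues, i.e. the positive diagonal entries of the matrix $D$ in a Williamson normal form $N^TAN=\begin{pmatrix}D&0\\0&D\end{pmatrix}$ with $N$ symplectic ($N^TJN=J$). For $1\le m\le n$ define $\sigma_m:\mathbb S(2n)\to(-\infty,\infty]$ by $\sigma_m(P)=-2\sum_{j=1}^m d_j(P)$ if $P\in\mathbb P(2n)$, and $\sigma_m(P)=\infty$ otherwise. Let $A\in\mathbb P(2n)$ and let $M=[u_1,\dots,u_n,v_1,\dots,v_n]$ be a real $2n\times 2n$ matrix whose columns satisfy, for all $j,k$, $\langle u_j,Ju_k\rangle=\langle v_j,Jv_k\rangle=0$, $\langle u_j,Jv_k\rangle=\delta_{jk}$, $Au_j=d_j(A)Jv_j$ and $Av_j=-d_j(A)Ju_j$.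 Let $i_m$ be the number of indices $k\le m$, and $j_m$ the number of indices $k>m$, with $d_k(A)=d_m(A)$, and put $r_m=i_m+j_m$. Let $\overline M$ be the submatrix of $M$ formed by the columns $u_k,v_k$ with $k\le m-i_m$, let $\widetilde M$ be the submatrix formed by those with $m-i_m<k\le m-i_m+r_m=m+j_m$, and let $\overline M\diamond\widetilde M=[u_1,\dots,u_{m+j_m},v_1,\dots,v_{m+j_m}]$. If $d_m(A)<d_{m+1}(A)$, where $d_{n+1}(A)=\infty$ by convention, then $\sigma_m$ is Gâteaux differentiable at $A$: it is finite in a neighbourhood of $A$, the limit $\sigma_m'(A;H)=\lim_{t\to0^+}\frac{\sigma_m(A+tH)-\sigma_m(A)}{t}$ exists in $\mathbb R$ for every $H\in\mathbb S(2n)$, and it is linear in $H$. Its gradient, i.e. the matrix $G\in\mathbb S(2n)$ with $\sigma_m'(A;H)=\langle G,H\rangle$ for all $H$, is $$\nabla\sigma_m(A)=-(\overline M\diamond\widetilde M)(\overline M\diamond\widetilde M)^T=-\sum_{k=1}^{m+j_m}\left(u_ku_k^T+v_kv_k^T\right).$$ -/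

import Mathlib

open Filter Topology Matrix

noncomputable section

/-- The real vector space of symmetric matrices, with the topology of entrywise convergence. -/
def SymMat (ι : Type) : Submodule ℝ (Matrix ι ι ℝ) where
  carrier := {X | X.IsSymm}
  add_mem' hX hY := Matrix.IsSymm.add hX hY
  zero_mem' := Matrix.isSymm_zero
  smul_mem' c _ hX := Matrix.IsSymm.smul hX c

/-- `-XXᵀ`, as an element of the space of symmetric matrices. -/
def negGram {ι κ : Type} [Fintype κ] (X : Matrix ι κ ℝ) : SymMat ι :=
  ⟨-(X * Xᵀ), by
    change (-(X * Xᵀ))ᵀ = -(X * Xᵀ)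
    simp [Matrix.transpose_mul]⟩

/-- The linear form `H ↦ ⟨G, H⟩ = tr (G H)` on symmetric matrices. -/
def tracePairing {ι : Type} [Fintype ι] (G : SymMat ι) : SymMat ι →ₗ[ℝ] ℝ where
  toFun H := Matrix.trace ((G : Matrix ι ι ℝ) * (H : Matrix ι ι ℝ))
  map_add' H K := by simp [mul_add]
  map_smul' c H := by simp

/-! ### Gâteaux differentiability of extended-real-valued functions of a symmetric matrix -/

/-- The one-sided directional derivative `f'(A; H)` exists in `ℝ` and equals `L`. -/
def HasDirDerivAt {ι : Type} (f : SymMat ι → EReal) (A H : SymMat ι) (L : ℝ) : Prop :=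
  Tendsto (fun t : ℝ => (f (A + t • H) - f A) / (t : EReal)) (𝓝[>] 0) (𝓝 (L : EReal))

/-- `f` is finite on an open set around `A`, all its one-sided directional derivatives at `A`
exist, and they form the linear map `L`. -/
def HasGateauxDerivAt {ι : Type} (f : SymMat ι → EReal) (A : SymMat ι)
    (L : SymMat ι →ₗ[ℝ] ℝ) : Prop :=
  (∃ O : Set (SymMat ι), IsOpen O ∧ A ∈ O ∧ ∀ X ∈ O, ∃ r : ℝ, f X = (r : EReal)) ∧
    ∀ H : SymMat ι, HasDirDerivAt f A H (L H)

/-- `f` is Gâteaux differentiable at `A`. -/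
def GateauxDifferentiableAt {ι : Type} (f : SymMat ι → EReal) (A : SymMat ι) : Prop :=
  ∃ L : SymMat ι →ₗ[ℝ] ℝ, HasGateauxDerivAt f A L

/-- `G` is the gradient of `f` at `A`: the Gâteaux derivative of `f` at `A` is `H ↦ tr (G H)`. -/
def HasGateauxGradientAt {ι : Type} [Fintype ι] (f : SymMat ι → EReal) (A G : SymMat ι) : Prop :=
  HasGateauxDerivAt f A (tracePairing G)

/-! ### Symplectic eigenvalues -/

/-- The standard matrix `J = [[0, I], [-I, 0]]` of order `2n`. It is the negative of Mathlib's
`Matrix.J`. -/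
def stdJ (n : ℕ) : Matrix (Fin n ⊕ Fin n) (Fin n ⊕ Fin n) ℝ :=
  Matrix.fromBlocks 0 1 (-1) 0

/-- Mathlib's symplectic group is the set of matrices with `Mᵀ J M = J` for this `J`, too. -/
theorem mem_symplecticGroup_iff_stdJ {n : ℕ} (M : Matrix (Fin n ⊕ Fin n) (Fin n ⊕ Fin n) ℝ) :
    M ∈ Matrix.symplecticGroup (Fin n) ℝ ↔ Mᵀ * stdJ n * M = stdJ n := by
  have h : stdJ n = -Matrix.J (Fin n) ℝ := by
    simp [stdJ, Matrix.J, Matrix.fromBlocks_neg]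
  rw [SymplecticGroup.mem_iff', h]
  simp

/-- `d₁ ≤ ⋯ ≤ dₙ` are the diagonal entries in a Williamson normal form of `A`: they are positive,
and `Mᵀ A M = diag(D, D)` for some symplectic matrix `M`, where `D = diag(d₁, …, dₙ)`. -/
def IsWilliamsonSpectrum {n : ℕ} (A : Matrix (Fin n ⊕ Fin n) (Fin n ⊕ Fin n) ℝ)
    (d : Fin n → ℝ) : Prop :=
  Monotone d ∧ (∀ j, 0 < d j) ∧
    ∃ M ∈ Matrix.symplecticGroup (Fin n) ℝ,
      Mᵀ * A * M = Matrix.fromBlocks (Matrix.diagonal d) 0 0 (Matrix.diagonal d)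

open Classical in
/-- The symplectic eigenvalues of `A` in increasing order, indexed from `0`. By Williamson's
theorem they exist, and are unique, for every positive definite `A`; other matrices that have no
Williamson normal form get the value `0`, which is never used. -/
def symplecticEigenvalue {n : ℕ} (A : Matrix (Fin n ⊕ Fin n) (Fin n ⊕ Fin n) ℝ) : Fin n → ℝ :=
  if h : ∃ d : Fin n → ℝ, IsWilliamsonSpectrum A d then h.choose else 0

open Classical in
/-- `σ_m(P) = -2 (d₁(P) + ⋯ + d_m(P))` for positive definite `P`, and `σ_m(P) = ∞` for every
other symmetric matrix `P`. -/
def sigma {n : ℕ} (m : ℕ) (P : SymMat (Fin n ⊕ Fin n)) : EReal :=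
  if (P : Matrix (Fin n ⊕ Fin n) (Fin n ⊕ Fin n) ℝ).PosDef then
    ((-2 * ∑ j : Fin n with j.val < m,
      symplecticEigenvalue (P : Matrix (Fin n ⊕ Fin n) (Fin n ⊕ Fin n) ℝ) j : ℝ) : EReal)
  else ⊤

/-- The set `Sp(2n, 2n, A)` of the matrices `[u₁, …, uₙ, v₁, …, vₙ]` whose columns form a
symplectically orthonormal set, with `A uⱼ = dⱼ(A) J vⱼ` and `A vⱼ = -dⱼ(A) J uⱼ` for all `j`. -/
def symplecticEigenbases {n : ℕ} (A : Matrix (Fin n ⊕ Fin n) (Fin n ⊕ Fin n) ℝ) :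
    Set (Matrix (Fin n ⊕ Fin n) (Fin n ⊕ Fin n) ℝ) :=
  {M | let u : Fin n → Fin n ⊕ Fin n → ℝ := fun j => M.col (Sum.inl j)
    let v : Fin n → Fin n ⊕ Fin n → ℝ := fun j => M.col (Sum.inr j)
    (∀ j k, u j ⬝ᵥ (stdJ n *ᵥ u k) = 0 ∧ v j ⬝ᵥ (stdJ n *ᵥ v k) = 0 ∧
      u j ⬝ᵥ (stdJ n *ᵥ v k) = if j = k then 1 else 0) ∧
    ∀ j, A *ᵥ u j = symplecticEigenvalue A j • (stdJ n *ᵥ v j) ∧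
      A *ᵥ v j = -(symplecticEigenvalue A j • (stdJ n *ᵥ u j))}

/-- The number `i_m` of indices `k ≤ m` with `d_k(A) = d_m(A)`. Here and in the two definitions
below, `p` is the position of `d_m(A)` counted from `0`, so `m = p + 1`. -/
def iMult {n : ℕ} (A : Matrix (Fin n ⊕ Fin n) (Fin n ⊕ Fin n) ℝ) (p : Fin n) : ℕ :=
  Nat.card {k : Fin n // k ≤ p ∧ symplecticEigenvalue A k = symplecticEigenvalue A p}

/-- The number `j_m` of indices `k > m` with `d_k(A) = d_m(A)`. -/
def jMult {n : ℕ} (A : Matrix (Fin n ⊕ Fin n) (Fin n ⊕ Fin n) ℝ) (p : Fin n) : ℕ :=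
  Nat.card {k : Fin n // p < k ∧ symplecticEigenvalue A k = symplecticEigenvalue A p}

/-- The multiplicity `r_m = i_m + j_m` of `d_m(A)`. -/
def rMult {n : ℕ} (A : Matrix (Fin n ⊕ Fin n) (Fin n ⊕ Fin n) ℝ) (p : Fin n) : ℕ :=
  iMult A p + jMult A p

/-! ### Symplectic column partitions -/

/-- The submatrix of `S = [u₁, …, uₙ, v₁, …, vₙ]` formed by the columns `uₖ`, `vₖ` with
`a < k ≤ a + b` (that is, `a ≤ k < a + b` when counted from `0`). -/
def symplecticColumns {ι : Type} {n : ℕ} (S : Matrix ι (Fin n ⊕ Fin n) ℝ) (a b : ℕ) :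
    Matrix ι ({k : Fin n // a ≤ k.val ∧ k.val < a + b} ⊕
      {k : Fin n // a ≤ k.val ∧ k.val < a + b}) ℝ :=
  S.submatrix id (Sum.map Subtype.val Subtype.val)

/-- The matrix `S ⋄ T`: first the `u`-columns of `S` and of `T`, then the `v`-columns of `S` and
of `T`. -/
def diamond {ι κ κ' : Type} (S : Matrix ι (κ ⊕ κ) ℝ) (T : Matrix ι (κ' ⊕ κ') ℝ) :
    Matrix ι ((κ ⊕ κ') ⊕ (κ ⊕ κ')) ℝ :=
  Matrix.of fun i => Sum.elim
    (Sum.elim (fun k => S i (Sum.inl k)) (fun k => T i (Sum.inl k)))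
    (Sum.elim (fun k => S i (Sum.inr k)) (fun k => T i (Sum.inr k)))

/-- The first block `M̄` in the symplectic column partition of `M` of order
`(m - i_m, r_m, n - m - j_m)`, with `m = p + 1`. -/
def barBlock {n : ℕ} (A M : Matrix (Fin n ⊕ Fin n) (Fin n ⊕ Fin n) ℝ) (p : Fin n) :
    Matrix (Fin n ⊕ Fin n)
      ({k : Fin n // 0 ≤ k.val ∧ k.val < 0 + (p.val + 1 - iMult A p)} ⊕
        {k : Fin n // 0 ≤ k.val ∧ k.val < 0 + (p.val + 1 - iMult A p)}) ℝ :=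
  symplecticColumns M 0 (p.val + 1 - iMult A p)

/-- The second block `M̃` in the same partition. -/
def tildeBlock {n : ℕ} (A M : Matrix (Fin n ⊕ Fin n) (Fin n ⊕ Fin n) ℝ) (p : Fin n) :
    Matrix (Fin n ⊕ Fin n)
      ({k : Fin n // p.val + 1 - iMult A p ≤ k.val ∧
          k.val < p.val + 1 - iMult A p + rMult A p} ⊕
        {k : Fin n // p.val + 1 - iMult A p ≤ k.val ∧
          k.val < p.val + 1 - iMult A p + rMult A p}) ℝ :=
  symplecticColumns M (p.val + 1 - iMult A p) (rMult A p)

end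

/-! The proof rests on a variational principle. Let `Q = initialProj n m`. The number 2(d₁(A) + ⋯ +
d_m(A)) is the minimum of tr(TᵀAT) over symplectic frames T (`IsFrame Q T`), and when d_m(A) <
d_{m+1}(A) every minimizer has the same Gram matrix TTᵀ = NQNᵀ, where N is any Williamson
diagonalizer of A (`trace_frame_ge`). So -σ_m is locally a minimum of functions linear in A, and an
envelope argument gives its derivative: the eigenframe of A bounds the slope along H above by
tr(NQNᵀH), minimizing frames at A + tH bound it below, and by compactness and uniqueness of the Gram
matrix the two bounds meet (`tendsto_slope_sum_symplecticEigenvalue`).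

For the lower bound, after reduction to A = diag(D, D), split T = X + Y into the parts commuting and
anticommuting with J. Then XᵀX = Q + YᵀY, and the trace splits as tr(XᵀDX) + tr(YᵀDY). Since XXᵀ
dominates an orthogonal projection of trace 2m (`exists_projection_le_gram`), a weighted-sum
estimate on the diagonal of that projection finishes (`weighted_sum_ge`). Equality forces Y = 0 and
makes the projection equal to Q.

Williamson's theorem is proved by minimizing tr(SᵀAS) over the symplectic group: at a minimizer,
SᵀAS commutes with J, hence is a complex Hermitian matrix, which a unitary diagonalizes
(`exists_isWilliamsonSpectrum`). -/

/-! ### Block-diagonal matrices commuting with J. -/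

/-- The block matrix `diag(D, D)` with `D = diag(d₁, …, dₙ)`. -/
noncomputable def dblDiag {n : ℕ} (d : Fin n → ℝ) : Matrix (Fin n ⊕ Fin n) (Fin n ⊕ Fin n) ℝ :=
  Matrix.fromBlocks (Matrix.diagonal d) 0 0 (Matrix.diagonal d)

/-- The orthogonal projection onto the first `m` coordinates of both halves. -/
noncomputable def initialProj (n m : ℕ) : Matrix (Fin n ⊕ Fin n) (Fin n ⊕ Fin n) ℝ :=
  dblDiag fun k => if k.val < m then 1 else 0

/-- `T` has the columns selected by `Q` as a symplectic frame and zeros elsewhere. -/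
noncomputable def IsFrame {n : ℕ} (Q T : Matrix (Fin n ⊕ Fin n) (Fin n ⊕ Fin n) ℝ) : Prop :=
  T * Q = T ∧ Tᵀ * stdJ n * T = stdJ n * Q

theorem stdJ_mul_self (n : ℕ) : stdJ n * stdJ n = -1 := by
  simp [stdJ, Matrix.fromBlocks_multiply, ← Matrix.fromBlocks_one, Matrix.fromBlocks_neg]

theorem stdJ_mul_stdJ_mul {n : ℕ} (X : Matrix (Fin n ⊕ Fin n) (Fin n ⊕ Fin n) ℝ) :
    stdJ n * (stdJ n * X) = -X := by
  rw [← mul_assoc, stdJ_mul_self]; simp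

theorem stdJ_transpose (n : ℕ) : (stdJ n)ᵀ = -stdJ n := by
  simp [stdJ, Matrix.fromBlocks_transpose, Matrix.fromBlocks_neg]

theorem dblDiag_eq_diagonal {n : ℕ} (d : Fin n → ℝ) :
    dblDiag d = Matrix.diagonal (Sum.elim d d) := by
  simp [dblDiag, Matrix.fromBlocks_diagonal]

theorem dblDiag_comm_stdJ {n : ℕ} (d : Fin n → ℝ) :
    dblDiag d * stdJ n = stdJ n * dblDiag d := by
  simp [dblDiag, stdJ, Matrix.fromBlocks_multiply, -Matrix.fromBlocks_diagonal]

theorem dblDiag_transpose {n : ℕ} (d : Fin n → ℝ) : (dblDiag d)ᵀ = dblDiag d := by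
  simp [dblDiag_eq_diagonal]

theorem dblDiag_mul {n : ℕ} (d e : Fin n → ℝ) :
    dblDiag d * dblDiag e = dblDiag fun k => d k * e k := by
  simp [dblDiag]

theorem trace_dblDiag {n : ℕ} (d : Fin n → ℝ) : (dblDiag d).trace = 2 * ∑ k, d k := by
  simp [dblDiag_eq_diagonal, Matrix.trace_diagonal]; ring

theorem dblDiag_one (n : ℕ) : dblDiag (fun _ : Fin n => (1 : ℝ)) = 1 := by
  rw [dblDiag_eq_diagonal, ← Matrix.diagonal_one]
  congr 1; ext i; cases i <;> rfl

theorem initialProj_mul_self (n m : ℕ) : initialProj n m * initialProj n m = initialProj n m := by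
  rw [initialProj, dblDiag_mul]
  congr 1; ext k; split_ifs <;> simp

theorem initialProj_transpose (n m : ℕ) : (initialProj n m)ᵀ = initialProj n m :=
  dblDiag_transpose _

theorem card_fin_filter_lt {n m : ℕ} (h : m ≤ n) : ∑ k : Fin n, (if k.val < m then (1 : ℝ) else 0) = m := by
  rw [Fin.sum_univ_eq_sum_range (fun k => if k < m then (1 : ℝ) else 0) n, Finset.sum_ite,
    Finset.sum_const_zero, add_zero, Finset.sum_const, nsmul_eq_mul, mul_one]
  congr 1
  have : (Finset.range n).filter (fun k => k < m) = Finset.range m := by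
    ext k; simp; omega
  rw [this, Finset.card_range]

theorem trace_initialProj {n m : ℕ} (h : m ≤ n) : (initialProj n m).trace = 2 * m := by
  rw [initialProj, trace_dblDiag, card_fin_filter_lt h]

/-! ### Complex-linear and antilinear parts of a frame. -/

section Decomposition

variable {n : ℕ} (T : Matrix (Fin n ⊕ Fin n) (Fin n ⊕ Fin n) ℝ)

/-- The part of `T` that commutes with `J`. -/
noncomputable def linPart : Matrix (Fin n ⊕ Fin n) (Fin n ⊕ Fin n) ℝ :=
  (1 / 2 : ℝ) • (T - stdJ n * T * stdJ n)

/-- The part of `T` that anticommutes with `J`. -/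
noncomputable def antilinPart : Matrix (Fin n ⊕ Fin n) (Fin n ⊕ Fin n) ℝ :=
  (1 / 2 : ℝ) • (T + stdJ n * T * stdJ n)

theorem linPart_add_antilinPart : linPart T + antilinPart T = T := by
  rw [linPart, antilinPart, ← smul_add, sub_add_add_cancel, ← two_smul ℝ T, smul_smul]
  norm_num

variable {T}

/-- In XᵀX - YᵀY only the cross terms TᵀJTJ and JTᵀJT survive, and the frame condition turns each
into -Q. -/
theorem linPart_gram_sub {Q : Matrix (Fin n ⊕ Fin n) (Fin n ⊕ Fin n) ℝ}
    (hQ : Q * stdJ n = stdJ n * Q) (hT : IsFrame Q T) :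
    (linPart T)ᵀ * linPart T = Q + (antilinPart T)ᵀ * antilinPart T := by
  have h1 : Tᵀ * (stdJ n * T) = stdJ n * Q := by rw [← mul_assoc]; exact hT.2
  have h2 : Tᵀ * (stdJ n * (T * stdJ n)) = -Q := by
    rw [← mul_assoc (stdJ n), ← mul_assoc, h1, mul_assoc, hQ, stdJ_mul_stdJ_mul]
  have h3 : stdJ n * (Tᵀ * (stdJ n * T)) = -Q := by rw [h1, stdJ_mul_stdJ_mul]
  simp only [linPart, antilinPart, transpose_smul, transpose_sub, transpose_add, transpose_mul,
    stdJ_transpose, smul_mul_assoc, mul_smul_comm, mul_sub, sub_mul, add_mul, mul_add, neg_mul,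
    mul_neg, mul_assoc, stdJ_mul_stdJ_mul, h1, h2, neg_neg]
  ext i j
  simp only [Matrix.add_apply, Matrix.sub_apply, Matrix.smul_apply, Matrix.neg_apply, smul_eq_mul]
  ring

/-- A parallelogram identity: 2X and 2Y are T ∓ JTJ, so cross terms cancel in the sum, and JTJ
contributes the same trace as T because D commutes with J. -/
theorem trace_conj_decomp {D : Matrix (Fin n ⊕ Fin n) (Fin n ⊕ Fin n) ℝ}
    (hD : D * stdJ n = stdJ n * D) :
    (Tᵀ * D * T).trace =
      ((linPart T)ᵀ * D * linPart T).trace + ((antilinPart T)ᵀ * D * antilinPart T).trace := by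
  have h1 (X : Matrix (Fin n ⊕ Fin n) (Fin n ⊕ Fin n) ℝ) :
      D * (stdJ n * X) = stdJ n * (D * X) := by rw [← mul_assoc, hD, mul_assoc]
  have h2 : (stdJ n * (Tᵀ * (D * (T * stdJ n)))).trace = - (Tᵀ * (D * T)).trace := by
    rw [Matrix.trace_mul_comm]
    simp only [mul_assoc, stdJ_mul_self, mul_neg, mul_one, Matrix.trace_neg]
  simp only [linPart, antilinPart, transpose_smul, transpose_sub, transpose_add, transpose_mul,
    stdJ_transpose, smul_mul_assoc, mul_smul_comm, mul_sub, sub_mul, add_mul, mul_add, neg_mul,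
    mul_neg, mul_assoc, h1, stdJ_mul_stdJ_mul, neg_neg, Matrix.trace_smul,
    Matrix.trace_add, Matrix.trace_sub, Matrix.trace_neg, h2, smul_eq_mul]
  ring

end Decomposition

/-! ### Trace inequalities and orthogonal projections. -/

theorem trace_transpose_mul_mul_nonneg {ι κ : Type*} [Fintype ι] [Fintype κ]
    {D : Matrix ι ι ℝ} (hD : D.PosSemidef) (V : Matrix ι κ ℝ) : 0 ≤ (Vᵀ * D * V).trace := by
  have := (hD.conjTranspose_mul_mul_same V).trace_nonneg
  rwa [Matrix.conjTranspose_eq_transpose_of_trivial] at this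

theorem trace_transpose_mul_self_nonneg {ι κ : Type*} [Fintype ι] [Fintype κ]
    (V : Matrix ι κ ℝ) : 0 ≤ (Vᵀ * V).trace := by
  classical
  have := trace_transpose_mul_mul_nonneg (D := (1 : Matrix ι ι ℝ)) Matrix.PosSemidef.one V
  rwa [Matrix.mul_one] at this

theorem trace_transpose_mul_self_le {ι κ : Type*} [Fintype ι] [Fintype κ] [DecidableEq ι]
    {A : Matrix ι ι ℝ} {c : ℝ} (h : (A - c • (1 : Matrix ι ι ℝ)).PosSemidef) (V : Matrix ι κ ℝ) :
    c * (Vᵀ * V).trace ≤ (Vᵀ * A * V).trace := by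
  have := trace_transpose_mul_mul_nonneg h V
  simp only [Matrix.mul_sub, Matrix.sub_mul, Matrix.mul_smul, Matrix.smul_mul, Matrix.mul_one,
    Matrix.trace_sub, Matrix.trace_smul, smul_eq_mul] at this
  linarith

theorem Matrix.PosDef.exists_pos_smul_one_le {ι : Type*} [Fintype ι] [DecidableEq ι]
    {A : Matrix ι ι ℝ} (hA : A.PosDef) :
    ∃ c : ℝ, 0 < c ∧ (A - c • (1 : Matrix ι ι ℝ)).PosSemidef := by
  have hH := hA.isHermitian
  obtain ⟨c, hc, hle⟩ : ∃ c : ℝ, 0 < c ∧ ∀ i, c ≤ hH.eigenvalues i := by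
    cases isEmpty_or_nonempty ι
    · exact ⟨1, one_pos, fun i => isEmptyElim i⟩
    · obtain ⟨i, hi⟩ := Finite.exists_min hH.eigenvalues
      exact ⟨_, hA.eigenvalues_pos i, hi⟩
  refine ⟨c, hc, ?_⟩
  set U : Matrix ι ι ℝ := (hH.eigenvectorUnitary).1
  have hUU : U * Uᴴ = 1 := Unitary.coe_mul_star_self hH.eigenvectorUnitary
  have hspec : A = U * Matrix.diagonal hH.eigenvalues * Uᴴ := hH.spectral_theorem
  have : A - c • (1 : Matrix ι ι ℝ) =
      U * Matrix.diagonal (fun i => hH.eigenvalues i - c) * Uᴴ := by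
    rw [← Matrix.diagonal_sub, mul_sub, sub_mul, ← hspec]
    congr 1
    rw [← Matrix.smul_one_eq_diagonal, mul_smul_comm, smul_mul_assoc, mul_one, hUU]
  rw [this]
  refine Matrix.PosSemidef.mul_mul_conjTranspose_same ?_ _
  exact Matrix.PosSemidef.diagonal fun i => sub_nonneg.2 (hle i)

/-- If `XᵀX = Q + YᵀY` with an idempotent `Q` such that `XQ = X`, then `XXᵀ` dominates an orthogonal
projection `P` (the one onto the range of `X`) with the same trace as `Q`. -/
theorem exists_projection_le_gram {ι : Type*} [Fintype ι] [DecidableEq ι]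
    {X Y Q : Matrix ι ι ℝ} (hQ : Q * Q = Q) (hXQ : X * Q = X)
    (hXY : Xᵀ * X = Q + Yᵀ * Y) :
    ∃ P : Matrix ι ι ℝ, Pᵀ = P ∧ P * P = P ∧ P.trace = Q.trace ∧
      (∀ D : Matrix ι ι ℝ, D.PosSemidef → (D * P).trace ≤ (Xᵀ * D * X).trace) ∧
      (Y = 0 → P = X * Xᵀ) := by
  set K := Yᵀ * Y with hK
  have hKs : Kᵀ = K := by simp [hK]
  have hG : (1 + K).PosDef := by
    refine Matrix.PosDef.one.add_posSemidef ?_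
    have := Matrix.posSemidef_conjTranspose_mul_self Y
    rwa [Matrix.conjTranspose_eq_transpose_of_trivial] at this
  have hu : IsUnit (1 + K).det := (Matrix.isUnit_iff_isUnit_det _).1 hG.isUnit
  -- On the range of Q, XᵀX acts as 1 + K; off it, X vanishes. Hence XᵀX may be replaced by the
  -- invertible 1 + K, and X(1 + K)⁻¹Xᵀ is the projection onto the range of X.
  obtain ⟨R, hR⟩ : ∃ R, R = (1 + K)⁻¹ := ⟨_, rfl⟩
  have hGR : (1 + K) * R = 1 := by rw [hR]; exact Matrix.mul_nonsing_inv _ hu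
  have hRG : R * (1 + K) = 1 := by rw [hR]; exact Matrix.nonsing_inv_mul _ hu
  have hRs : Rᵀ = R := by
    rw [hR, Matrix.transpose_nonsing_inv, Matrix.transpose_add, hKs, Matrix.transpose_one]
  have hX1 : X * (1 - Q) = 0 := by rw [mul_sub, mul_one, hXQ, sub_self]
  have hXX : Xᵀ * X = (1 + K) - (1 - Q) := by rw [hXY]; abel
  have hG1 : (1 + K) * (1 - Q) = 1 - Q := by
    have : K * (1 - Q) = - (Q * (1 - Q)) := by
      have h := congrArg (fun Z => Xᵀ * Z) hX1
      simp only [← mul_assoc, hXY, mul_zero, add_mul] at h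
      exact eq_neg_of_add_eq_zero_right h
    have hQQ : Q * (1 - Q) = 0 := by rw [mul_sub, mul_one, hQ, sub_self]
    rw [add_mul, one_mul, this, hQQ]; simp
  have hR1 : R * (1 - Q) = 1 - Q := by
    rw [← hG1, ← mul_assoc, hRG, one_mul, hG1]
  have hKR : K * R = R * K := by
    have h1 : R + K * R = 1 := by rw [← hGR]; noncomm_ring
    have h2 : R + R * K = 1 := by rw [← hRG]; noncomm_ring
    exact add_left_cancel (h1.trans h2.symm)
  refine ⟨X * R * Xᵀ, ?_, ?_, ?_, ?_, ?_⟩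
  · simp [Matrix.transpose_mul, hRs, mul_assoc]
  · calc X * R * Xᵀ * (X * R * Xᵀ) = X * R * (Xᵀ * X) * R * Xᵀ := by simp only [mul_assoc]
      _ = X * (R * (1 + K)) * R * Xᵀ - X * (R * (1 - Q)) * R * Xᵀ := by rw [hXX]; noncomm_ring
      _ = X * R * Xᵀ := by rw [hRG, hR1, hX1]; simp
  · rw [Matrix.trace_mul_comm, ← mul_assoc, Matrix.trace_mul_comm, hXX, mul_sub, hRG, hR1]
    simp
  · intro D hD
    -- From 1 - R = R(K + K²)R, the difference is a sum of two Gram matrices, so its trace against a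
    -- positive semidefinite D is nonnegative.
    have hdiff : X * Xᵀ - X * R * Xᵀ =
        (X * R * Yᵀ) * (X * R * Yᵀ)ᵀ + (X * R * K) * (X * R * K)ᵀ := by
      have : (1 : Matrix ι ι ℝ) - R = R * K * R + R * (K * K) * R := by
        calc 1 - R = R * (1 + K) * (1 + K) * R - R * (1 + K) * R := by
              rw [hRG, one_mul, one_mul, hGR]
          _ = _ := by noncomm_ring
      calc X * Xᵀ - X * R * Xᵀ = X * (1 - R) * Xᵀ := by noncomm_ring
        _ = _ := by
          rw [this]
          simp only [Matrix.transpose_mul, Matrix.transpose_transpose, hRs, mul_add, add_mul,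
            mul_assoc, hK]
    have e : (Xᵀ * D * X).trace - (D * (X * R * Xᵀ)).trace =
        ((X * R * Yᵀ)ᵀ * D * (X * R * Yᵀ)).trace + ((X * R * K)ᵀ * D * (X * R * K)).trace := by
      have e1 (V : Matrix ι ι ℝ) : (Vᵀ * D * V).trace = (D * (V * Vᵀ)).trace := by
        rw [Matrix.trace_mul_comm, ← mul_assoc, Matrix.trace_mul_comm]
      rw [e1, e1, e1, ← Matrix.trace_sub, ← Matrix.trace_add, ← mul_sub, ← mul_add, hdiff]
    have := trace_transpose_mul_mul_nonneg hD (X * R * Yᵀ)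
    have := trace_transpose_mul_mul_nonneg hD (X * R * K)
    linarith
  · intro hY
    have : K = 0 := by simp [hK, hY]
    have : R = 1 := by simpa [this] using hRG
    rw [this, mul_one]

theorem diag_mem_Icc_of_projection {ι : Type*} [Fintype ι] {P : Matrix ι ι ℝ}
    (hs : Pᵀ = P) (hP : P * P = P) (i : ι) : 0 ≤ P i i ∧ P i i ≤ 1 := by
  have h1 : P i i = ∑ j, P i j ^ 2 := by
    conv_lhs => rw [← hP, Matrix.mul_apply]
    refine Finset.sum_congr rfl fun j _ => ?_
    rw [sq, ← Matrix.transpose_apply P i j, hs]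
  have h2 : P i i ^ 2 ≤ P i i := by
    conv_rhs => rw [h1]
    exact Finset.single_le_sum (f := fun j => P i j ^ 2) (fun j _ => sq_nonneg _)
      (Finset.mem_univ i)
  exact ⟨by nlinarith, by nlinarith⟩

/-- Since the q k sum to 2m, d may be shifted by c = d_m without changing the difference of the two
sides. It becomes ∑ (d k - c)(q k - 2·[k < m]), whose terms are all nonnegative; a gap after d_m
makes d k - c positive for the later k, so equality kills their weights. -/
theorem weighted_sum_ge {n m : ℕ} (hm : 1 ≤ m) (hmn : m ≤ n) {d q : Fin n → ℝ} (hd : Monotone d)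
    (hq0 : ∀ k, 0 ≤ q k) (hq2 : ∀ k, q k ≤ 2) (hq : ∑ k, q k = 2 * m) :
    2 * ∑ k : Fin n with k.val < m, d k ≤ ∑ k, d k * q k ∧
      ((∀ h : m < n, d ⟨m - 1, Nat.sub_one_lt_of_le hm hmn⟩ < d ⟨m, h⟩) →
        ∑ k, d k * q k ≤ 2 * ∑ k : Fin n with k.val < m, d k → ∀ k : Fin n, m ≤ k.val → q k = 0) := by
  set c := d ⟨m - 1, Nat.sub_one_lt_of_le hm hmn⟩ with hc
  have key : ∑ k, d k * q k - 2 * ∑ k : Fin n with k.val < m, d k =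
      ∑ k : Fin n, (d k - c) * (q k - 2 * if k.val < m then 1 else 0) := by
    have h1 : ∑ k : Fin n, c * (q k - 2 * if k.val < m then (1 : ℝ) else 0) = 0 := by
      rw [← Finset.mul_sum, Finset.sum_sub_distrib, hq, ← Finset.mul_sum, card_fin_filter_lt hmn]
      simp
    have h2 : ∑ k : Fin n, (d k - c) * (q k - 2 * if k.val < m then (1 : ℝ) else 0) =
        ∑ k : Fin n, d k * (q k - 2 * if k.val < m then (1 : ℝ) else 0) := by
      simp only [sub_mul _ c]
      rw [Finset.sum_sub_distrib, h1, sub_zero]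
    rw [h2, Finset.sum_filter, Finset.mul_sum, ← Finset.sum_sub_distrib]
    refine Finset.sum_congr rfl fun k _ => ?_
    split_ifs <;> ring
  have hterm : ∀ k ∈ Finset.univ, 0 ≤ (d k - c) * (q k - 2 * if k.val < m then (1 : ℝ) else 0) := by
    intro k _
    split_ifs with hk
    · refine mul_nonneg_of_nonpos_of_nonpos ?_ (by linarith [hq2 k])
      exact sub_nonpos.2 (hd (Fin.le_def.2 (by simp only; omega)))
    · refine mul_nonneg ?_ (by linarith [hq0 k])
      exact sub_nonneg.2 (hd (Fin.le_def.2 (by simp only; omega)))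
  refine ⟨by linarith [Finset.sum_nonneg hterm], fun hgap hle k hk => ?_⟩
  have h0 := (Finset.sum_eq_zero_iff_of_nonneg hterm).1
    (le_antisymm (by linarith) (Finset.sum_nonneg hterm)) k (Finset.mem_univ k)
  rw [if_neg (by omega), mul_zero, sub_zero] at h0
  have hck : c < d k := (hgap (by omega)).trans_le (hd (Fin.le_def.2 hk))
  exact (mul_eq_zero.1 h0).resolve_left (by linarith)

/-- Two orthogonal projections of the same trace coincide if the trace of their product is that
trace as well. -/
theorem projection_eq_of_trace {ι : Type*} [Fintype ι] {P Q : Matrix ι ι ℝ}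
    (hPs : Pᵀ = P) (hP : P * P = P) (hQs : Qᵀ = Q) (hQ : Q * Q = Q)
    (h1 : P.trace = Q.trace) (h2 : (P * Q).trace = Q.trace) : P = Q := by
  have h : ((P - Q)ᴴ * (P - Q)).trace = 0 := by
    rw [Matrix.conjTranspose_eq_transpose_of_trivial, Matrix.transpose_sub, hPs, hQs, sub_mul,
      mul_sub, mul_sub, hP, hQ]
    simp only [Matrix.trace_sub, Matrix.trace_mul_comm Q P, h1, h2]
    ring
  exact sub_eq_zero.1 (Matrix.trace_conjTranspose_mul_self_eq_zero_iff.1 h)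

/-! ### The trace bound for frames when A = diag(D, D). -/

theorem trace_dblDiag_mul {n : ℕ} (d : Fin n → ℝ) (P : Matrix (Fin n ⊕ Fin n) (Fin n ⊕ Fin n) ℝ) :
    (dblDiag d * P).trace = ∑ k, d k * (P (Sum.inl k) (Sum.inl k) + P (Sum.inr k) (Sum.inr k)) := by
  simp [dblDiag_eq_diagonal, Matrix.trace, Finset.sum_add_distrib, mul_add]

theorem trace_frame_dblDiag_ge {n m : ℕ} (hm : 1 ≤ m) (hmn : m ≤ n) {d : Fin n → ℝ}
    (hd : Monotone d) (hpos : ∀ k, 0 < d k) {T : Matrix (Fin n ⊕ Fin n) (Fin n ⊕ Fin n) ℝ}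
    (hT : IsFrame (initialProj n m) T) :
    2 * ∑ k : Fin n with k.val < m, d k ≤ (Tᵀ * dblDiag d * T).trace ∧
      ((∀ h : m < n, d ⟨m - 1, Nat.sub_one_lt_of_le hm hmn⟩ < d ⟨m, h⟩) →
        (Tᵀ * dblDiag d * T).trace ≤ 2 * ∑ k : Fin n with k.val < m, d k →
          T * Tᵀ = initialProj n m) := by
  have hDpos : (dblDiag d).PosDef := by
    rw [dblDiag_eq_diagonal]
    exact Matrix.PosDef.diagonal (by rintro (k | k) <;> exact hpos k)
  have hXQ : linPart T * initialProj n m = linPart T := by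
    have h := dblDiag_comm_stdJ (fun k : Fin n => if k.val < m then (1 : ℝ) else 0)
    rw [← initialProj] at h
    rw [linPart, smul_mul_assoc, sub_mul, mul_assoc _ (stdJ n), ← h, ← mul_assoc, mul_assoc _ T,
      hT.1]
  obtain ⟨P, hPs, hPP, hPtr, hPle, hPY⟩ := exists_projection_le_gram (initialProj_mul_self n m) hXQ
    (linPart_gram_sub (dblDiag_comm_stdJ _) hT)
  have hY := trace_transpose_mul_mul_nonneg hDpos.posSemidef (antilinPart T)
  have hX := hPle _ hDpos.posSemidef
  have hdec := trace_conj_decomp (T := T) (dblDiag_comm_stdJ d)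
  have hdiag := diag_mem_Icc_of_projection hPs hPP
  set q : Fin n → ℝ := fun k => P (Sum.inl k) (Sum.inl k) + P (Sum.inr k) (Sum.inr k) with hqdef
  have hDP : (dblDiag d * P).trace = ∑ k, d k * q k := trace_dblDiag_mul d P
  have hq : ∑ k, q k = 2 * m := by
    rw [← trace_initialProj hmn, ← hPtr]
    simp [hqdef, Matrix.trace, Finset.sum_add_distrib]
  obtain ⟨hge, heq⟩ := weighted_sum_ge hm hmn hd
    (fun k => add_nonneg (hdiag (Sum.inl k)).1 (hdiag (Sum.inr k)).1)
    (fun k => by linarith [(hdiag (Sum.inl k)).2, (hdiag (Sum.inr k)).2]) hq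
  refine ⟨by linarith, fun hgap hle => ?_⟩
  -- Equality leaves no room for tr(YᵀDY), and D is positive definite.
  have hY0 : antilinPart T = 0 := by
    obtain ⟨c, hc, hcD⟩ := hDpos.exists_pos_smul_one_le
    have h1 := trace_transpose_mul_self_le hcD (antilinPart T)
    have h2 := trace_transpose_mul_self_nonneg (antilinPart T)
    rw [← Matrix.trace_conjTranspose_mul_self_eq_zero_iff,
      Matrix.conjTranspose_eq_transpose_of_trivial]
    nlinarith
  have hTX : T = linPart T := by
    conv_lhs => rw [← linPart_add_antilinPart T, hY0, add_zero]
  have hq0 := heq hgap (by linarith)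
  rw [hTX, ← hPY hY0]
  refine projection_eq_of_trace hPs hPP (initialProj_transpose n m) (initialProj_mul_self n m)
    hPtr ?_
  -- The weights beyond m vanish, so Q already captures the full trace 2m of P.
  rw [Matrix.trace_mul_comm, initialProj, trace_dblDiag_mul, ← initialProj, trace_initialProj hmn,
    ← hq]
  refine Finset.sum_congr rfl fun k _ => ?_
  split_ifs with hk
  · rw [one_mul]
  · rw [zero_mul]; exact (hq0 k (by omega)).symm

/-! ### Perturbation bounds and compactness. -/

/-- Because |xᵢxⱼ| ≤ x·x, the entrywise ℓ¹ norm bounds the quadratic form. This crude bound suffices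
for openness arguments. -/
theorem posSemidef_smul_one_add {ι : Type*} [Fintype ι] [DecidableEq ι] {S : Matrix ι ι ℝ}
    (hS : S.IsSymm) {c : ℝ} (hc : ∑ i, ∑ j, |S i j| ≤ c) :
    (c • (1 : Matrix ι ι ℝ) + S).PosSemidef := by
  refine Matrix.PosSemidef.of_dotProduct_mulVec_nonneg ?_ fun x => ?_
  · rw [Matrix.IsHermitian, Matrix.conjTranspose_eq_transpose_of_trivial, Matrix.transpose_add,
      hS.eq]
    simp
  rw [star_trivial, Matrix.add_mulVec, dotProduct_add, Matrix.smul_mulVec, Matrix.one_mulVec,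
    dotProduct_smul, smul_eq_mul]
  have hx (i : ι) : x i ^ 2 ≤ x ⬝ᵥ x := by
    rw [sq]
    exact Finset.single_le_sum (f := fun i => x i * x i) (fun j _ => mul_self_nonneg _)
      (Finset.mem_univ i)
  have h0 : 0 ≤ x ⬝ᵥ x := Finset.sum_nonneg fun i _ => mul_self_nonneg (x i)
  have h1 : -((∑ i, ∑ j, |S i j|) * (x ⬝ᵥ x)) ≤ x ⬝ᵥ S *ᵥ x := by
    have h2 : x ⬝ᵥ S *ᵥ x = ∑ i, ∑ j, x i * (S i j * x j) := by
      simp [dotProduct, Matrix.mulVec, Finset.mul_sum]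
    rw [h2, Finset.sum_mul, ← Finset.sum_neg_distrib]
    simp only [Finset.sum_mul, ← Finset.sum_neg_distrib]
    refine Finset.sum_le_sum fun i _ => Finset.sum_le_sum fun j _ => ?_
    have h2 : |x i * x j| ≤ x ⬝ᵥ x := by
      rw [abs_le]
      constructor <;> nlinarith [hx i, hx j, sq_nonneg (x i + x j), sq_nonneg (x i - x j)]
    have h3 : |x i * (S i j * x j)| ≤ |S i j| * (x ⬝ᵥ x) := by
      rw [show x i * (S i j * x j) = S i j * (x i * x j) by ring, abs_mul]
      exact mul_le_mul_of_nonneg_left h2 (abs_nonneg _)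
    exact (abs_le.1 h3).1
  have := mul_le_mul_of_nonneg_right hc h0
  linarith

theorem posSemidef_sub_smul_one_of_close {ι : Type*} [Fintype ι] [DecidableEq ι]
    {A B : Matrix ι ι ℝ} {c : ℝ} (hA : (A - c • (1 : Matrix ι ι ℝ)).PosSemidef)
    (hAB : (B - A).IsSymm) (h : ∑ i, ∑ j, |B i j - A i j| ≤ c / 2) :
    (B - (c / 2) • (1 : Matrix ι ι ℝ)).PosSemidef := by
  have := hA.add (posSemidef_smul_one_add hAB h)
  have e : A - c • (1 : Matrix ι ι ℝ) + ((c / 2) • (1 : Matrix ι ι ℝ) + (B - A)) =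
      B - (c / 2) • (1 : Matrix ι ι ℝ) := by
    module
  rwa [e] at this

theorem Matrix.PosSemidef.posDef_of_sub_smul_one {ι : Type*} [Fintype ι] [DecidableEq ι]
    {A : Matrix ι ι ℝ} {c : ℝ} (hc : 0 < c) (hA : (A - c • (1 : Matrix ι ι ℝ)).PosSemidef) :
    A.PosDef := by
  simpa using Matrix.PosDef.add_posSemidef (Matrix.PosDef.one.smul hc) hA

theorem isCompact_trace_transpose_mul_self_le {ι : Type*} [Fintype ι] (C : ℝ) :
    IsCompact {T : Matrix ι ι ℝ | (Tᵀ * T).trace ≤ C} := by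
  have hK : IsCompact {T : Matrix ι ι ℝ | ∀ i, T i ∈ Set.univ.pi fun _ => Set.Icc (-√C) √C} :=
    isCompact_pi_infinite fun _ => isCompact_univ_pi fun _ => isCompact_Icc
  refine hK.of_isClosed_subset (isClosed_le (by fun_prop) continuous_const) ?_
  intro T hT i j _
  refine abs_le.1 (Real.abs_le_sqrt (le_trans ?_ hT))
  have : (Tᵀ * T).trace = ∑ j, ∑ i, T i j ^ 2 := by
    simp [Matrix.trace, Matrix.mul_apply, sq]
  rw [this]
  exact (Finset.single_le_sum (f := fun i => T i j ^ 2) (fun _ _ => sq_nonneg _)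
    (Finset.mem_univ i)).trans
    (Finset.single_le_sum (f := fun j => ∑ i, T i j ^ 2)
      (fun _ _ => Finset.sum_nonneg fun _ _ => sq_nonneg _) (Finset.mem_univ j))

/-! ### Williamson's theorem by minimization over the symplectic group. -/

theorem isClosed_setOf_isFrame {n : ℕ} (Q : Matrix (Fin n ⊕ Fin n) (Fin n ⊕ Fin n) ℝ) :
    IsClosed {T | IsFrame Q T} :=
  (isClosed_eq (by fun_prop) (by fun_prop)).inter (isClosed_eq (by fun_prop) (by fun_prop))

theorem isFrame_one_iff {n : ℕ} {T : Matrix (Fin n ⊕ Fin n) (Fin n ⊕ Fin n) ℝ} :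
    IsFrame 1 T ↔ T ∈ Matrix.symplecticGroup (Fin n) ℝ := by
  rw [mem_symplecticGroup_iff_stdJ]
  simp [IsFrame]

/-- The objective is at least c·tr(TᵀT), while T = 1 gives tr A. Only the compact set tr(TᵀT) ≤ tr A
/ c can therefore compete. -/
theorem exists_symplectic_minimizer {n : ℕ} {A : Matrix (Fin n ⊕ Fin n) (Fin n ⊕ Fin n) ℝ}
    (hA : A.PosDef) :
    ∃ S ∈ Matrix.symplecticGroup (Fin n) ℝ, ∀ T ∈ Matrix.symplecticGroup (Fin n) ℝ,
      (Sᵀ * A * S).trace ≤ (Tᵀ * A * T).trace := by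
  obtain ⟨c, hc, hcA⟩ := hA.exists_pos_smul_one_le
  have hcont : Continuous fun T : Matrix (Fin n ⊕ Fin n) (Fin n ⊕ Fin n) ℝ => (Tᵀ * A * T).trace := by
    fun_prop
  have h1 : (1 : Matrix (Fin n ⊕ Fin n) (Fin n ⊕ Fin n) ℝ) ∈
      {T | (Tᵀ * T).trace ≤ A.trace / c} ∩ {T | IsFrame 1 T} := by
    refine ⟨?_, isFrame_one_iff.2 (one_mem _)⟩
    have := trace_transpose_mul_self_le hcA (1 : Matrix (Fin n ⊕ Fin n) (Fin n ⊕ Fin n) ℝ)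
    rw [transpose_one, one_mul, one_mul, mul_one] at this
    rw [Set.mem_ofPred_eq, transpose_one, one_mul, le_div_iff₀ hc]
    linarith
  obtain ⟨S, hS, hmin⟩ := ((isCompact_trace_transpose_mul_self_le (A.trace / c)).inter_right
    (isClosed_setOf_isFrame 1)).exists_isMinOn ⟨1, h1⟩ hcont.continuousOn
  refine ⟨S, isFrame_one_iff.1 hS.2, fun T hT => ?_⟩
  by_cases h : (Tᵀ * T).trace ≤ A.trace / c
  · exact hmin ⟨h, isFrame_one_iff.2 hT⟩
  · have h2 : (Sᵀ * A * S).trace ≤ A.trace := by simpa using hmin h1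
    have h3 := trace_transpose_mul_self_le hcA T
    rw [not_le, div_lt_iff₀ hc] at h
    linarith

/-- These are symplectic transvections: xᵀJx = 0 kills the quadratic term in a. They are the test
curves for the first-order condition at a minimizer. -/
theorem vecMulVec_mul_stdJ_symplectic {n : ℕ} (a : ℝ) (x : Fin n ⊕ Fin n → ℝ) :
    1 + a • (Matrix.vecMulVec x x * stdJ n) ∈ Matrix.symplecticGroup (Fin n) ℝ := by
  have h0 : x ⬝ᵥ stdJ n *ᵥ x = 0 := by
    have h : x ⬝ᵥ stdJ n *ᵥ x = -(x ⬝ᵥ stdJ n *ᵥ x) := by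
      conv_lhs => rw [Matrix.dotProduct_mulVec, ← Matrix.mulVec_transpose, stdJ_transpose,
        Matrix.neg_mulVec, neg_dotProduct, dotProduct_comm]
    linarith
  have h1 : Matrix.vecMulVec x x * (stdJ n * Matrix.vecMulVec x x) = 0 := by
    rw [Matrix.mul_vecMulVec, Matrix.vecMulVec_mul_vecMulVec, h0, zero_smul, Matrix.vecMulVec_zero]
  rw [mem_symplecticGroup_iff_stdJ]
  simp only [transpose_add, transpose_one, transpose_smul, transpose_mul, stdJ_transpose,
    Matrix.transpose_vecMulVec, add_mul, mul_add, one_mul, mul_one, smul_mul_assoc, mul_smul_comm,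
    mul_assoc, neg_mul]
  rw [← mul_assoc (stdJ n) (vecMulVec x x) (stdJ n), ← mul_assoc (vecMulVec x x) _ (stdJ n), h1]
  simp

theorem eq_zero_of_forall_quadratic_nonneg {b q : ℝ}
    (h : ∀ a : ℝ, 0 ≤ a * (2 * b) + a ^ 2 * q) : b = 0 := by
  have hs : 0 < |q| + 1 := by positivity
  -- The denominator |q| + 1 makes the linear term dominate whatever the sign of q, and never
  -- vanishes.
  have h1 := h (-b / (|q| + 1))
  have h2 : -b / (|q| + 1) * (2 * b) + (-b / (|q| + 1)) ^ 2 * q =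
      -(b ^ 2 * (2 * (|q| + 1) - q)) / (|q| + 1) ^ 2 := by
    field_simp
    ring
  rw [h2] at h1
  replace h1 := (div_nonneg_iff.1 h1).resolve_right fun h => absurd h.2 (not_le.2 (by positivity))
  replace h1 := h1.1
  have h3 := le_abs_self q
  have h4 : b ^ 2 ≤ 0 := by nlinarith [abs_nonneg q, sq_nonneg b]
  exact pow_eq_zero_iff two_ne_zero |>.1 (le_antisymm h4 (sq_nonneg b))

/-- Stationarity along the transvection of x reads xᵀJBx = 0. By polarization JB is skew, which for
symmetric B means that B and J commute. -/
theorem comm_stdJ_of_minimizer {n : ℕ} {B : Matrix (Fin n ⊕ Fin n) (Fin n ⊕ Fin n) ℝ}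
    (hB : B.IsSymm) (hmin : ∀ T ∈ Matrix.symplecticGroup (Fin n) ℝ,
      B.trace ≤ (Tᵀ * B * T).trace) : B * stdJ n = stdJ n * B := by
  have hx (x : Fin n ⊕ Fin n → ℝ) : x ⬝ᵥ (stdJ n * B) *ᵥ x = 0 := by
    set V := Matrix.vecMulVec x x * stdJ n with hV
    have htr : (B * V).trace = x ⬝ᵥ (stdJ n * B) *ᵥ x := by
      rw [hV, ← mul_assoc, Matrix.trace_mul_comm, ← mul_assoc, Matrix.mul_vecMulVec,
        Matrix.trace_vecMulVec, dotProduct_comm]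
    have htr' : (Vᵀ * B).trace = (B * V).trace := by
      rw [← Matrix.trace_transpose, Matrix.transpose_mul, Matrix.transpose_transpose, hB.eq]
    have hexp (a : ℝ) : 0 ≤ a * (2 * (B * V).trace) + a ^ 2 * (Vᵀ * B * V).trace := by
      have := hmin _ (vecMulVec_mul_stdJ_symplectic a x)
      rw [← hV] at this
      simp only [transpose_add, transpose_one, transpose_smul, add_mul, mul_add, one_mul, mul_one,
        smul_mul_assoc, mul_smul_comm, Matrix.trace_add, Matrix.trace_smul, smul_eq_mul, htr'] at this
      linarith
    rw [← htr]
    exact eq_zero_of_forall_quadratic_nonneg hexp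
  have hskew : (stdJ n * B)ᵀ = -(stdJ n * B) := by
    ext i j
    have h1 := hx (Pi.single i 1 + Pi.single j 1)
    have h2 := hx (Pi.single i 1)
    have h3 := hx (Pi.single j 1)
    simp only [Matrix.mulVec_add, add_dotProduct, dotProduct_add, h2, h3] at h1
    simp at h1
    simp only [Matrix.transpose_apply, Matrix.neg_apply]
    linarith
  rw [Matrix.transpose_mul, hB.eq, stdJ_transpose, mul_neg, neg_inj] at hskew
  exact hskew

/-- The real `2n × 2n` matrix of a complex `n × n` matrix. -/
noncomputable def realify {n : ℕ} (Z : Matrix (Fin n) (Fin n) ℂ) : Matrix (Fin n ⊕ Fin n) (Fin n ⊕ Fin n) ℝ :=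
  Matrix.fromBlocks (Z.map Complex.re) (Z.map Complex.im) (-Z.map Complex.im) (Z.map Complex.re)

theorem realify_mul {n : ℕ} (Z W : Matrix (Fin n) (Fin n) ℂ) :
    realify (Z * W) = realify Z * realify W := by
  rw [realify, realify, realify, Matrix.fromBlocks_multiply]
  congr 1 <;> ext i j <;>
    simp [Matrix.mul_apply, Finset.sum_sub_distrib, Finset.sum_add_distrib] <;> ring

theorem realify_conjTranspose {n : ℕ} (Z : Matrix (Fin n) (Fin n) ℂ) :
    realify Zᴴ = (realify Z)ᵀ := by
  rw [realify, realify, Matrix.fromBlocks_transpose]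
  congr 1; ext i j; simp

theorem realify_diagonal {n : ℕ} (d : Fin n → ℝ) :
    realify (Matrix.diagonal fun k => (d k : ℂ)) = dblDiag d := by
  rw [realify, dblDiag]
  congr 1 <;> ext i j <;> by_cases h : i = j <;> simp [h]

theorem realify_comm_stdJ {n : ℕ} (Z : Matrix (Fin n) (Fin n) ℂ) :
    realify Z * stdJ n = stdJ n * realify Z := by
  simp [realify, stdJ, Matrix.fromBlocks_multiply]

/-- Commuting with J forces the block form [[P, R], [-R, P]]; symmetry of B then makes P symmetric
and R skew, so P + iR is Hermitian. -/
theorem exists_realify_of_comm {n : ℕ} {B : Matrix (Fin n ⊕ Fin n) (Fin n ⊕ Fin n) ℝ}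
    (hB : B.IsSymm) (hc : B * stdJ n = stdJ n * B) :
    ∃ Z : Matrix (Fin n) (Fin n) ℂ, Z.IsHermitian ∧ B = realify Z := by
  have h (i j) := congrFun (congrFun hc i) j
  rw [← Matrix.fromBlocks_toBlocks B] at h hB
  simp only [stdJ, Matrix.fromBlocks_multiply] at h
  rw [Matrix.IsSymm, Matrix.fromBlocks_transpose, Matrix.fromBlocks_inj] at hB
  have h1 : B.toBlocks₂₁ = -B.toBlocks₁₂ := by
    ext i j; have := h (Sum.inl i) (Sum.inl j); simp at this; simp [← this]
  have h2 : B.toBlocks₂₂ = B.toBlocks₁₁ := by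
    ext i j; have := h (Sum.inl i) (Sum.inr j); simp at this; simp [← this]
  refine ⟨Matrix.of fun i j => ⟨B.toBlocks₁₁ i j, B.toBlocks₁₂ i j⟩, ?_, ?_⟩
  · ext i j
    have e1 := congrFun (congrFun hB.1 i) j
    have e2 := congrFun (congrFun hB.2.2.1 i) j
    rw [h1] at e2
    simp at e1 e2
    apply Complex.ext
    · simpa using e1
    · simp [e2]
  · rw [realify]
    conv_lhs => rw [← Matrix.fromBlocks_toBlocks B, h1, h2]
    congr 1

theorem exists_realify_unitary_diagonalization {n : ℕ} {Z : Matrix (Fin n) (Fin n) ℂ}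
    (hZ : Z.IsHermitian) :
    ∃ (U : Matrix (Fin n) (Fin n) ℂ) (d : Fin n → ℝ), Monotone d ∧ Uᴴ * U = 1 ∧
      Uᴴ * Z * U = Matrix.diagonal fun k => (d k : ℂ) := by
  set e := Tuple.sort hZ.eigenvalues
  set U : Matrix (Fin n) (Fin n) ℂ := (hZ.eigenvectorUnitary).1
  have hUU : Uᴴ * U = 1 := Unitary.coe_star_mul_self hZ.eigenvectorUnitary
  have hspec : Z = U * Matrix.diagonal (fun k => (hZ.eigenvalues k : ℂ)) * Uᴴ := hZ.spectral_theorem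
  refine ⟨U.submatrix id e, hZ.eigenvalues ∘ e, Tuple.monotone_sort _, ?_, ?_⟩
  · rw [Matrix.conjTranspose_submatrix, ← Matrix.submatrix_mul _ _ _ _ _ Function.bijective_id, hUU,
      Matrix.submatrix_one_equiv]
  · have h : Uᴴ * Z * U = Matrix.diagonal fun k => (hZ.eigenvalues k : ℂ) := by
      calc _ = Uᴴ * (U * Matrix.diagonal (fun k => (hZ.eigenvalues k : ℂ)) * Uᴴ) * U :=
            congrArg (fun W => Uᴴ * W * U) hspec
        _ = (Uᴴ * U) * Matrix.diagonal (fun k => (hZ.eigenvalues k : ℂ)) * (Uᴴ * U) := by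
            simp only [mul_assoc]
        _ = _ := by rw [hUU, one_mul, mul_one]
    have h' : (U.submatrix id e)ᴴ * Z * U.submatrix id e = (Uᴴ * Z * U).submatrix e e := by
      rw [Matrix.conjTranspose_submatrix, Matrix.submatrix_mul _ _ _ _ _ Function.bijective_id,
        Matrix.submatrix_mul _ _ _ _ _ Function.bijective_id, Matrix.submatrix_id_id]
    rw [h', h, Matrix.submatrix_diagonal_equiv]
    rfl

/-- The realification of the diagonalizing unitary is orthogonal and commutes with J, hence
symplectic; composed with the minimizer S it gives the normal form. -/
theorem exists_isWilliamsonSpectrum {n : ℕ} {A : Matrix (Fin n ⊕ Fin n) (Fin n ⊕ Fin n) ℝ}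
    (hA : A.PosDef) : ∃ d : Fin n → ℝ, IsWilliamsonSpectrum A d := by
  obtain ⟨S, hS, hmin⟩ := exists_symplectic_minimizer hA
  have hAs : Aᵀ = A := by
    have := hA.isHermitian
    rwa [Matrix.IsHermitian, Matrix.conjTranspose_eq_transpose_of_trivial] at this
  have hBs : (Sᵀ * A * S).IsSymm := by
    simp [Matrix.IsSymm, Matrix.transpose_mul, hAs, mul_assoc]
  obtain ⟨Z, hZ, hBZ⟩ := exists_realify_of_comm hBs (comm_stdJ_of_minimizer hBs fun T hT => by
    have := hmin _ (mul_mem hS hT)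
    simpa only [Matrix.transpose_mul, mul_assoc] using this)
  obtain ⟨U, d, hd, hU, hdU⟩ := exists_realify_unitary_diagonalization hZ
  have hone : realify (1 : Matrix (Fin n) (Fin n) ℂ) = 1 := by
    have := realify_diagonal (fun _ : Fin n => (1 : ℝ))
    rw [dblDiag_one] at this
    simpa using this
  have hRR : (realify U)ᵀ * realify U = 1 := by
    rw [← realify_conjTranspose, ← realify_mul, hU, hone]
  have hR : realify U ∈ Matrix.symplecticGroup (Fin n) ℝ := by
    rw [mem_symplecticGroup_iff_stdJ, mul_assoc, ← realify_comm_stdJ, ← mul_assoc, hRR, one_mul]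
  have hD : (S * realify U)ᵀ * A * (S * realify U) = dblDiag d := by
    rw [← realify_diagonal, ← hdU, realify_mul, realify_mul, ← hBZ, realify_conjTranspose,
      Matrix.transpose_mul]
    simp only [mul_assoc]
  refine ⟨d, hd, fun j => ?_, S * realify U, mul_mem hS hR, hD⟩
  have hpos : (dblDiag d).PosDef := by
    rw [← hD, ← Matrix.conjTranspose_eq_transpose_of_trivial]
    refine hA.conjTranspose_mul_mul_same ?_
    rw [Matrix.mulVec_injective_iff_isUnit, Matrix.isUnit_iff_isUnit_det]
    exact SymplecticGroup.symplectic_det (mul_mem hS hR)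
  simpa [dblDiag] using hpos.diag_pos (i := Sum.inl j)

/-! ### The variational principle for positive definite A. -/

section Williamson

variable {n m : ℕ} {A N T : Matrix (Fin n ⊕ Fin n) (Fin n ⊕ Fin n) ℝ} {d : Fin n → ℝ}

theorem isFrame_mul (hN : N ∈ Matrix.symplecticGroup (Fin n) ℝ)
    {Q : Matrix (Fin n ⊕ Fin n) (Fin n ⊕ Fin n) ℝ} (hT : IsFrame Q T) : IsFrame Q (N * T) := by
  refine ⟨by rw [mul_assoc, hT.1], ?_⟩
  calc (N * T)ᵀ * stdJ n * (N * T) = Tᵀ * (Nᵀ * stdJ n * N) * T := by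
        rw [Matrix.transpose_mul]; simp only [mul_assoc]
    _ = stdJ n * Q := by rw [(mem_symplecticGroup_iff_stdJ N).1 hN, hT.2]

theorem isFrame_initialProj (n m : ℕ) : IsFrame (initialProj n m) (initialProj n m) := by
  refine ⟨initialProj_mul_self n m, ?_⟩
  rw [initialProj_transpose, initialProj, dblDiag_comm_stdJ, mul_assoc, ← initialProj,
    initialProj_mul_self]

/-- Left multiplication by N⁻¹ preserves frames, so this reduces to diag(D, D). It is stated for
arbitrary Williamson data, to be used at A and at A + tH alike. -/
theorem trace_frame_ge (hm : 1 ≤ m) (hmn : m ≤ n) (hd : Monotone d) (hpos : ∀ k, 0 < d k)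
    (hN : N ∈ Matrix.symplecticGroup (Fin n) ℝ) (hNA : Nᵀ * A * N = dblDiag d)
    (hT : IsFrame (initialProj n m) T) :
    2 * ∑ k : Fin n with k.val < m, d k ≤ (Tᵀ * A * T).trace ∧
      ((∀ h : m < n, d ⟨m - 1, Nat.sub_one_lt_of_le hm hmn⟩ < d ⟨m, h⟩) →
        (Tᵀ * A * T).trace ≤ 2 * ∑ k : Fin n with k.val < m, d k →
          T * Tᵀ = N * initialProj n m * Nᵀ) := by
  obtain ⟨L, hL, hNL⟩ : ∃ L ∈ Matrix.symplecticGroup (Fin n) ℝ, N * L = 1 := by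
    refine ⟨_, ((⟨N, hN⟩ : Matrix.symplecticGroup (Fin n) ℝ)⁻¹).2, ?_⟩
    have := mul_inv_cancel (⟨N, hN⟩ : Matrix.symplecticGroup (Fin n) ℝ)
    exact congrArg Subtype.val this
  have hTL : T = N * (L * T) := by rw [← mul_assoc, hNL, one_mul]
  have h1 : Tᵀ * A * T = (L * T)ᵀ * dblDiag d * (L * T) := by
    conv_lhs => rw [hTL]
    rw [← hNA, Matrix.transpose_mul N]
    simp only [mul_assoc]
  obtain ⟨h2, h3⟩ := trace_frame_dblDiag_ge hm hmn hd hpos (isFrame_mul hL hT)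
  rw [h1]
  refine ⟨h2, fun hgap hle => ?_⟩
  rw [← h3 hgap hle]
  conv_lhs => rw [hTL]
  rw [Matrix.transpose_mul N]
  simp only [mul_assoc]

theorem trace_eigenframe (hNA : Nᵀ * A * N = dblDiag d) :
    ((N * initialProj n m)ᵀ * A * (N * initialProj n m)).trace =
      2 * ∑ k : Fin n with k.val < m, d k := by
  have h : (N * initialProj n m)ᵀ * A * (N * initialProj n m) =
      initialProj n m * (Nᵀ * A * N) * initialProj n m := by
    rw [Matrix.transpose_mul, initialProj_transpose]
    simp only [mul_assoc]
  rw [h, hNA, initialProj, dblDiag_mul, dblDiag_mul, trace_dblDiag, Finset.sum_filter]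
  congr 1
  refine Finset.sum_congr rfl fun k _ => ?_
  split_ifs <;> simp

end Williamson

theorem isWilliamsonSpectrum_symplecticEigenvalue {n : ℕ}
    {A : Matrix (Fin n ⊕ Fin n) (Fin n ⊕ Fin n) ℝ} (hA : A.PosDef) :
    IsWilliamsonSpectrum A (symplecticEigenvalue A) := by
  have h := exists_isWilliamsonSpectrum hA
  rw [symplecticEigenvalue, dif_pos h]
  exact h.choose_spec

/-- `2 (d₁(A) + ⋯ + d_m(A))` is attained as `tr (TᵀAT)` for some symplectic frame `T`. -/
theorem exists_minimizing_frame {n : ℕ} (m : ℕ) {A : Matrix (Fin n ⊕ Fin n) (Fin n ⊕ Fin n) ℝ}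
    (hA : A.PosDef) : ∃ T, IsFrame (initialProj n m) T ∧
      (Tᵀ * A * T).trace = 2 * ∑ k : Fin n with k.val < m, symplecticEigenvalue A k := by
  obtain ⟨-, -, N, hN, hNA⟩ := isWilliamsonSpectrum_symplecticEigenvalue hA
  exact ⟨_, isFrame_mul hN (isFrame_initialProj n m), trace_eigenframe hNA⟩

/-! ### The derivative along a line. -/

theorem eventually_posDef_line {ι : Type*} [Fintype ι] [DecidableEq ι] {A H : Matrix ι ι ℝ}
    (hH : H.IsSymm) {c : ℝ} (hc : 0 < c) (hcA : (A - c • (1 : Matrix ι ι ℝ)).PosSemidef) :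
    ∀ᶠ t : ℝ in 𝓝 0, (A + t • H - (c / 2) • (1 : Matrix ι ι ℝ)).PosSemidef := by
  have h : Tendsto (fun t : ℝ => ∑ i, ∑ j, |(A + t • H) i j - A i j|) (𝓝 0)
      (𝓝 (∑ i, ∑ j, |(A + (0 : ℝ) • H) i j - A i j|)) := by
    refine Continuous.tendsto ?_ _
    simp only [Matrix.add_apply, Matrix.smul_apply]
    fun_prop
  have h0 : ∑ i, ∑ j, |(A + (0 : ℝ) • H) i j - A i j| < c / 2 := by simpa using hc
  filter_upwards [h.eventually_lt_const h0] with t ht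
  refine posSemidef_sub_smul_one_of_close hcA ?_ ht.le
  rw [add_sub_cancel_left]
  exact hH.smul t

section Derivative

variable {n m : ℕ} {A N H : Matrix (Fin n ⊕ Fin n) (Fin n ⊕ Fin n) ℝ}

theorem trace_line (T : Matrix (Fin n ⊕ Fin n) (Fin n ⊕ Fin n) ℝ) (t : ℝ) :
    (Tᵀ * (A + t • H) * T).trace = (Tᵀ * A * T).trace + t * (Tᵀ * H * T).trace := by
  simp [mul_add, add_mul]

theorem trace_conj_eq (T : Matrix (Fin n ⊕ Fin n) (Fin n ⊕ Fin n) ℝ) :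
    (Tᵀ * H * T).trace = (T * Tᵀ * H).trace := by
  rw [Matrix.trace_mul_comm, ← mul_assoc]

theorem tendsto_trace_conj {α : Type*} {l : Filter α}
    {S : α → Matrix (Fin n ⊕ Fin n) (Fin n ⊕ Fin n) ℝ}
    {S₀ : Matrix (Fin n ⊕ Fin n) (Fin n ⊕ Fin n) ℝ} (hS : Tendsto S l (𝓝 S₀))
    (H : Matrix (Fin n ⊕ Fin n) (Fin n ⊕ Fin n) ℝ) :
    Tendsto (fun a => ((S a)ᵀ * H * S a).trace) l (𝓝 (S₀ᵀ * H * S₀).trace) := by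
  have hcont : Continuous fun T : Matrix (Fin n ⊕ Fin n) (Fin n ⊕ Fin n) ℝ =>
      (Tᵀ * H * T).trace := by fun_prop
  exact (hcont.tendsto S₀).comp hS

/-- One-sided derivative of the sum of the `2m` smallest symplectic eigenvalues along a line. -/
theorem tendsto_slope_sum_symplecticEigenvalue (hm : 1 ≤ m) (hmn : m ≤ n) (hA : A.PosDef)
    (hH : H.IsSymm) (hN : N ∈ Matrix.symplecticGroup (Fin n) ℝ)
    (hNA : Nᵀ * A * N = dblDiag (symplecticEigenvalue A))
    (hgap : ∀ h : m < n, symplecticEigenvalue A ⟨m - 1, Nat.sub_one_lt_of_le hm hmn⟩ <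
      symplecticEigenvalue A ⟨m, h⟩) :
    Tendsto (fun t : ℝ => (2 * ∑ k : Fin n with k.val < m, symplecticEigenvalue (A + t • H) k -
        2 * ∑ k : Fin n with k.val < m, symplecticEigenvalue A k) / t) (𝓝[>] 0)
      (𝓝 (N * initialProj n m * Nᵀ * H).trace) := by
  obtain ⟨hd, hpos, -⟩ := isWilliamsonSpectrum_symplecticEigenvalue hA
  set φ : ℝ → ℝ := fun t => 2 * ∑ k : Fin n with k.val < m, symplecticEigenvalue (A + t • H) k
  set φ₀ : ℝ := 2 * ∑ k : Fin n with k.val < m, symplecticEigenvalue A k with hφ₀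
  set g := (N * initialProj n m * Nᵀ * H).trace with hg
  obtain ⟨c, hc, hcA⟩ := hA.exists_pos_smul_one_le
  have hev : ∀ᶠ t : ℝ in 𝓝[>] 0, 0 < t ∧ t < 1 ∧
      (A + t • H - (c / 2) • (1 : Matrix (Fin n ⊕ Fin n) (Fin n ⊕ Fin n) ℝ)).PosSemidef := by
    filter_upwards [self_mem_nhdsWithin, nhdsWithin_le_nhds (eventually_lt_nhds one_pos),
      nhdsWithin_le_nhds (eventually_posDef_line hH hc hcA)] with t h1 h2 h3
    exact ⟨h1, h2, h3⟩
  -- A minimizing frame at A + tH. The positivity condition sits inside the existential so that S is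
  -- a function of all t; elsewhere it is 0.
  have hS (t : ℝ) : ∃ S, (A + t • H).PosDef → IsFrame (initialProj n m) S ∧
      (Sᵀ * (A + t • H) * S).trace = φ t := by
    by_cases h : (A + t • H).PosDef
    · obtain ⟨S, hS⟩ := exists_minimizing_frame m h
      exact ⟨S, fun _ => hS⟩
    · exact ⟨0, fun h' => absurd h' h⟩
  choose S hS using hS
  -- Test the problem at A + tH with the fixed eigenframe NQ of A.
  have hupper : ∀ᶠ t : ℝ in 𝓝[>] 0, φ t ≤ φ₀ + t * g := by
    filter_upwards [hev] with t ⟨_, _, ht⟩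
    obtain ⟨hd', hpos', N', hN', hNA'⟩ := isWilliamsonSpectrum_symplecticEigenvalue
      (ht.posDef_of_sub_smul_one (half_pos hc))
    have := (trace_frame_ge hm hmn hd' hpos' hN' hNA'
      (isFrame_mul hN (isFrame_initialProj n m))).1
    rw [trace_line, trace_eigenframe hNA, trace_conj_eq, Matrix.transpose_mul,
      initialProj_transpose, mul_assoc N, ← mul_assoc (initialProj n m), initialProj_mul_self,
      ← mul_assoc] at this
    exact this
  -- Test the problem at A with the minimizer S t of the perturbed problem.
  have hlower : ∀ᶠ t : ℝ in 𝓝[>] 0, φ₀ + t * ((S t)ᵀ * H * S t).trace ≤ φ t := by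
    filter_upwards [hev] with t ⟨_, _, ht⟩
    obtain ⟨h1, h2⟩ := hS t (ht.posDef_of_sub_smul_one (half_pos hc))
    have := (trace_frame_ge hm hmn hd hpos hN hNA h1).1
    rw [← h2, trace_line]
    linarith
  -- The lower bound c/2 for A + tH is uniform in t, and t < 1 bounds the minimum by φ₀ + |g|; so
  -- all S t lie in one compact set.
  have hK : ∀ᶠ t : ℝ in 𝓝[>] 0, S t ∈ {T | (Tᵀ * T).trace ≤ (φ₀ + |g|) / (c / 2)} ∩
      {T | IsFrame (initialProj n m) T} := by
    filter_upwards [hev, hupper] with t ⟨h0, h1, ht⟩ hu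
    obtain ⟨h2, h3⟩ := hS t (ht.posDef_of_sub_smul_one (half_pos hc))
    refine ⟨?_, h2⟩
    have h4 := trace_transpose_mul_self_le ht (S t)
    rw [Set.mem_ofPred_eq, le_div_iff₀ (half_pos hc)]
    have h5 : t * g ≤ |g| := by
      have := mul_le_mul_of_nonneg_left (le_abs_self g) h0.le
      nlinarith [abs_nonneg g]
    linarith
  have hlim : Tendsto (fun t => ((S t)ᵀ * H * S t).trace) (𝓝[>] 0) (𝓝 g) := by
    -- S t itself need not converge, as minimizers are not unique. Along each ultrafilter it does,
    -- and only the limit's Gram matrix matters.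
    rw [tendsto_iff_ultrafilter]
    intro U hU
    obtain ⟨S₀, hS₀, hle⟩ := ((isCompact_trace_transpose_mul_self_le _).inter_right
      (isClosed_setOf_isFrame (initialProj n m))).ultrafilter_le_nhds (U.map S)
        (le_principal_iff.2 (hU hK))
    have hSt : Tendsto S U (𝓝 S₀) := hle
    have ht0 : Tendsto (fun t : ℝ => t) U (𝓝 0) := hU.trans nhdsWithin_le_nhds
    have hlimA : Tendsto (fun t => (((S t)ᵀ * (A + t • H) * S t).trace)) U
        (𝓝 (S₀ᵀ * A * S₀).trace) := by
      have := (tendsto_trace_conj hSt A).add (ht0.mul (tendsto_trace_conj hSt H))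
      rw [zero_mul, add_zero] at this
      exact this.congr fun t => (trace_line _ _).symm
    have hle0 : (S₀ᵀ * A * S₀).trace ≤ φ₀ := by
      have h2 : Tendsto (fun t : ℝ => φ₀ + t * g) U (𝓝 (φ₀ + 0 * g)) :=
        (ht0.mul_const g).const_add φ₀
      rw [zero_mul, add_zero] at h2
      refine le_of_tendsto_of_tendsto hlimA h2 (hU ?_)
      filter_upwards [hev, hupper] with t ⟨_, _, ht⟩ hu
      exact (hS t (ht.posDef_of_sub_smul_one (half_pos hc))).2.trans_le hu
    -- The limit frame minimizes at A; the gap then fixes its Gram matrix, so every ultrafilter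
    -- yields the same limit g.
    have hS₀S₀ := (trace_frame_ge hm hmn hd hpos hN hNA hS₀.2).2 hgap hle0
    rw [hg, ← hS₀S₀, ← trace_conj_eq]
    exact tendsto_trace_conj hSt H
  refine tendsto_of_tendsto_of_tendsto_of_le_of_le' hlim tendsto_const_nhds ?_ ?_
  · filter_upwards [hev, hlower] with t ⟨h0, _⟩ h
    rw [le_div_iff₀ h0]; linarith
  · filter_upwards [hev, hupper] with t ⟨h0, _⟩ h
    rw [div_le_iff₀ h0]; linarith

end Derivative

/-! ### Eigenbases, multiplicities and the gradient formula. -/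

/-- The eigenvector equations turn each entry of MᵀAM into a symplectic product of columns. Thus M
can play the role of the diagonalizer N. -/
theorem mem_symplecticGroup_of_mem_symplecticEigenbases {n : ℕ}
    {A M : Matrix (Fin n ⊕ Fin n) (Fin n ⊕ Fin n) ℝ} (hM : M ∈ symplecticEigenbases A) :
    M ∈ Matrix.symplecticGroup (Fin n) ℝ ∧ Mᵀ * A * M = dblDiag (symplecticEigenvalue A) := by
  obtain ⟨hJ, hA⟩ := hM
  have entry (B : Matrix (Fin n ⊕ Fin n) (Fin n ⊕ Fin n) ℝ) (i j) :
      (Mᵀ * B * M) i j = M.col i ⬝ᵥ (B *ᵥ M.col j) := by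
    rw [mul_assoc]; rfl
  have hvu (j k : Fin n) : M.col (Sum.inr j) ⬝ᵥ (stdJ n *ᵥ M.col (Sum.inl k)) =
      -if j = k then 1 else 0 := by
    rw [Matrix.dotProduct_mulVec, ← Matrix.mulVec_transpose, stdJ_transpose, Matrix.neg_mulVec,
      neg_dotProduct, dotProduct_comm, (hJ k j).2.2]
    simp [eq_comm]
  refine ⟨(mem_symplecticGroup_iff_stdJ M).2 ?_, ?_⟩
  · ext (j | j) (k | k) <;> rw [entry]
    · rw [(hJ j k).1]; simp [stdJ]
    · rw [(hJ j k).2.2]; simp [stdJ, Matrix.one_apply]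
    · rw [hvu]; simp [stdJ, Matrix.one_apply]
    · rw [(hJ j k).2.1]; simp [stdJ]
  · ext (j | j) (k | k) <;> rw [entry, dblDiag]
    · rw [(hA k).1, dotProduct_smul, (hJ j k).2.2]
      by_cases h : j = k <;> simp [h]
    · rw [(hA k).2, dotProduct_neg, dotProduct_smul, (hJ j k).1]; simp
    · rw [(hA k).1, dotProduct_smul, (hJ j k).2.1]; simp
    · rw [(hA k).2, dotProduct_neg, dotProduct_smul, hvu]
      by_cases h : j = k <;> simp [h]

/-- Ensures that the natural-number subtraction m - i_m in the column blocks does not truncate. -/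
theorem iMult_le {n : ℕ} (A : Matrix (Fin n ⊕ Fin n) (Fin n ⊕ Fin n) ℝ) (p : Fin n) :
    iMult A p ≤ p.val + 1 := by
  rw [iMult, ← Nat.card_fin (p.val + 1)]
  refine Nat.card_le_card_of_injective (fun k => ⟨k.1.val, Nat.lt_succ_of_le k.2.1⟩) ?_
  intro k l h
  exact Subtype.ext (Fin.ext (Fin.mk.inj h))

/-- With the gap, the columns counted up to m + j_m are exactly those selected by `initialProj n m`.
-/
theorem jMult_eq_zero {n : ℕ} {A : Matrix (Fin n ⊕ Fin n) (Fin n ⊕ Fin n) ℝ}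
    (hmono : Monotone (symplecticEigenvalue A)) (p : Fin n)
    (hgap : ∀ h : p.val + 1 < n, symplecticEigenvalue A p < symplecticEigenvalue A ⟨p.val + 1, h⟩) :
    jMult A p = 0 := by
  rw [jMult, Nat.card_eq_zero]
  left
  refine ⟨fun ⟨k, hk, he⟩ => ?_⟩
  have h1 : p.val + 1 ≤ k.val := hk
  have h2 := hmono (a := ⟨p.val + 1, by omega⟩) (b := k) h1
  have h3 := hgap (by omega)
  linarith

theorem sum_subtype_Ico_add {n : ℕ} (a b : ℕ) (F : Fin n → ℝ) :
    ∑ k : {k : Fin n // 0 ≤ k.val ∧ k.val < 0 + a}, F k +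
      ∑ k : {k : Fin n // a ≤ k.val ∧ k.val < a + b}, F k =
        ∑ k : Fin n with k.val < a + b, F k := by
  rw [← Finset.sum_subtype (Finset.univ.filter fun k : Fin n => k.val < a) (by simp) F,
    ← Finset.sum_subtype (Finset.univ.filter fun k : Fin n => a ≤ k.val ∧ k.val < a + b) (by simp) F,
    ← Finset.sum_union]
  · congr 1; ext k; simp; omega
  · rw [Finset.disjoint_filter]; intro k _ h; omega

theorem diamond_gram {n : ℕ} {ι : Type} (M : Matrix ι (Fin n ⊕ Fin n) ℝ) (a b : ℕ) :
    diamond (symplecticColumns M 0 a) (symplecticColumns M a b) *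
        (diamond (symplecticColumns M 0 a) (symplecticColumns M a b))ᵀ =
      ∑ k : Fin n with k.val < a + b,
        (Matrix.vecMulVec (M.col (Sum.inl k)) (M.col (Sum.inl k)) +
          Matrix.vecMulVec (M.col (Sum.inr k)) (M.col (Sum.inr k))) := by
  ext i j
  have h1 := sum_subtype_Ico_add a b fun k => M i (Sum.inl k) * M j (Sum.inl k)
  have h2 := sum_subtype_Ico_add a b fun k => M i (Sum.inr k) * M j (Sum.inr k)
  rw [Matrix.sum_apply]
  simp only [Matrix.add_apply, Matrix.vecMulVec_apply, Matrix.col_apply, Finset.sum_add_distrib]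
  rw [← h1, ← h2, Matrix.mul_apply, Fintype.sum_sum_type, Fintype.sum_sum_type,
    Fintype.sum_sum_type]
  rfl

theorem mul_initialProj_mul_transpose {n : ℕ} (M : Matrix (Fin n ⊕ Fin n) (Fin n ⊕ Fin n) ℝ)
    (m : ℕ) : M * initialProj n m * Mᵀ = ∑ k : Fin n with k.val < m,
      (Matrix.vecMulVec (M.col (Sum.inl k)) (M.col (Sum.inl k)) +
        Matrix.vecMulVec (M.col (Sum.inr k)) (M.col (Sum.inr k))) := by
  ext i j
  rw [Matrix.sum_apply, Matrix.mul_apply, initialProj, dblDiag_eq_diagonal]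
  simp [Matrix.vecMulVec_apply, Finset.sum_add_distrib, Finset.sum_filter]

theorem sigma_of_posDef {n : ℕ} (m : ℕ) {P : SymMat (Fin n ⊕ Fin n)}
    (hP : (P : Matrix (Fin n ⊕ Fin n) (Fin n ⊕ Fin n) ℝ).PosDef) :
    sigma m P = ((-2 * ∑ k : Fin n with k.val < m,
      symplecticEigenvalue (P : Matrix (Fin n ⊕ Fin n) (Fin n ⊕ Fin n) ℝ) k : ℝ) : EReal) :=
  if_pos hP

theorem hasGateauxDerivAt_sigma {n m : ℕ} (hm : 1 ≤ m) (hmn : m ≤ n)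
    {A : SymMat (Fin n ⊕ Fin n)} (hA : (A : Matrix (Fin n ⊕ Fin n) (Fin n ⊕ Fin n) ℝ).PosDef)
    {M : Matrix (Fin n ⊕ Fin n) (Fin n ⊕ Fin n) ℝ}
    (hM : M ∈ symplecticEigenbases (A : Matrix (Fin n ⊕ Fin n) (Fin n ⊕ Fin n) ℝ))
    (hgap : ∀ h : m < n,
      symplecticEigenvalue (A : Matrix (Fin n ⊕ Fin n) (Fin n ⊕ Fin n) ℝ)
          ⟨m - 1, Nat.sub_one_lt_of_le hm hmn⟩ <
        symplecticEigenvalue (A : Matrix (Fin n ⊕ Fin n) (Fin n ⊕ Fin n) ℝ) ⟨m, h⟩)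
    {G : SymMat (Fin n ⊕ Fin n)}
    (hG : (G : Matrix (Fin n ⊕ Fin n) (Fin n ⊕ Fin n) ℝ) = -(M * initialProj n m * Mᵀ)) :
    HasGateauxGradientAt (sigma m) A G := by
  obtain ⟨c, hc, hcA⟩ := hA.exists_pos_smul_one_le
  -- An entrywise ℓ¹ ball of radius c/2, inside which matrices remain positive definite and σ_m is
  -- finite.
  refine ⟨⟨{X | ∑ i, ∑ j, |X.1 i j - A.1 i j| < c / 2}, ?_, by simpa using hc, fun X hX => ?_⟩,
    fun H => ?_⟩
  · refine isOpen_lt (continuous_finsetSum _ fun i _ => continuous_finsetSum _ fun j _ => ?_)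
      continuous_const
    exact ((continuous_subtype_val.matrix_elem i j).sub continuous_const).abs
  · exact ⟨_, sigma_of_posDef m ((posSemidef_sub_smul_one_of_close hcA (X - A).2
      (le_of_lt hX)).posDef_of_sub_smul_one (half_pos hc))⟩
  · obtain ⟨hN, hNA⟩ := mem_symplecticGroup_of_mem_symplecticEigenbases hM
    have h := (tendsto_slope_sum_symplecticEigenvalue hm hmn hA H.2 hN hNA hgap).neg
    have hval : tracePairing G H = -(M * initialProj n m * Mᵀ * H.1).trace := by
      change ((G : Matrix (Fin n ⊕ Fin n) (Fin n ⊕ Fin n) ℝ) * H.1).trace = _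
      rw [hG, neg_mul, Matrix.trace_neg]
    rw [HasDirDerivAt, hval]
    -- For small t both values of σ_m are finite, so the extended-real quotient is the coercion of
    -- the real slope.
    refine ((continuous_coe_real_ereal.tendsto _).comp h).congr' ?_
    filter_upwards [nhdsWithin_le_nhds (eventually_posDef_line H.2 hc hcA)] with t ht
    have hP : ((A + t • H : SymMat (Fin n ⊕ Fin n)) :
        Matrix (Fin n ⊕ Fin n) (Fin n ⊕ Fin n) ℝ).PosDef :=
      ht.posDef_of_sub_smul_one (half_pos hc)
    rw [sigma_of_posDef m hP, sigma_of_posDef m hA, ← EReal.coe_sub, ← EReal.coe_div,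
      Function.comp_apply]
    congr 1
    rw [← neg_div]
    congr 1
    simp only [Submodule.coe_add, Submodule.coe_smul]
    ring

theorem mainTheorem6 {n : ℕ} (m : ℕ) (hm : 1 ≤ m) (hmn : m ≤ n)
    (A : SymMat (Fin n ⊕ Fin n))
    (hA : (A : Matrix (Fin n ⊕ Fin n) (Fin n ⊕ Fin n) ℝ).PosDef)
    (M : Matrix (Fin n ⊕ Fin n) (Fin n ⊕ Fin n) ℝ)
    (hM : M ∈ symplecticEigenbases (A : Matrix (Fin n ⊕ Fin n) (Fin n ⊕ Fin n) ℝ))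
    -- `d_m(A) < d_{m+1}(A)`, which is an empty condition for `m = n`
    (hgap : ∀ h : m < n,
      symplecticEigenvalue (A : Matrix (Fin n ⊕ Fin n) (Fin n ⊕ Fin n) ℝ) ⟨m - 1, by omega⟩ <
        symplecticEigenvalue (A : Matrix (Fin n ⊕ Fin n) (Fin n ⊕ Fin n) ℝ) ⟨m, h⟩) :
    GateauxDifferentiableAt (sigma m) A ∧
    HasGateauxGradientAt (sigma m) A
      (negGram (diamond (barBlock A M ⟨m - 1, by omega⟩) (tildeBlock A M ⟨m - 1, by omega⟩))) ∧
    ((negGram (diamond (barBlock A M ⟨m - 1, by omega⟩) (tildeBlock A M ⟨m - 1, by omega⟩)) :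
        SymMat (Fin n ⊕ Fin n)) : Matrix (Fin n ⊕ Fin n) (Fin n ⊕ Fin n) ℝ) =
      -∑ k : Fin n with k.val < m + jMult (A : Matrix (Fin n ⊕ Fin n) (Fin n ⊕ Fin n) ℝ)
          ⟨m - 1, by omega⟩,
        (Matrix.vecMulVec (M.col (Sum.inl k)) (M.col (Sum.inl k)) +
          Matrix.vecMulVec (M.col (Sum.inr k)) (M.col (Sum.inr k))) := by
  have hmono := (isWilliamsonSpectrum_symplecticEigenvalue hA).1
  have hi := iMult_le (A : Matrix (Fin n ⊕ Fin n) (Fin n ⊕ Fin n) ℝ) ⟨m - 1, by omega⟩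
  have hj : jMult (A : Matrix (Fin n ⊕ Fin n) (Fin n ⊕ Fin n) ℝ) ⟨m - 1, by omega⟩ = 0 := by
    refine jMult_eq_zero hmono _ fun h => ?_
    have h' : m < n := by simp only at h; omega
    convert hgap h' using 3
    simp only; omega
  have hG : ((negGram (diamond (barBlock A M ⟨m - 1, by omega⟩)
      (tildeBlock A M ⟨m - 1, by omega⟩)) : SymMat (Fin n ⊕ Fin n)) :
        Matrix (Fin n ⊕ Fin n) (Fin n ⊕ Fin n) ℝ) =
      -∑ k : Fin n with k.val < m + jMult (A : Matrix (Fin n ⊕ Fin n) (Fin n ⊕ Fin n) ℝ)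
          ⟨m - 1, by omega⟩,
        (Matrix.vecMulVec (M.col (Sum.inl k)) (M.col (Sum.inl k)) +
          Matrix.vecMulVec (M.col (Sum.inr k)) (M.col (Sum.inr k))) := by
    -- The block widths add up as (m - i_m) + (i_m + j_m) = m + j_m, using i_m ≤ m.
    refine congrArg Neg.neg ((diamond_gram M _ _).trans ?_)
    congr 1
    ext k
    rw [Finset.mem_filter, Finset.mem_filter, rMult]
    simp only [Finset.mem_univ, true_and]
    dsimp only at hi
    omega
  have hgrad := hasGateauxDerivAt_sigma hm hmn hA hM hgap
    (hG.trans (by rw [hj, add_zero, mul_initialProj_mul_transpose]))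
  exact ⟨⟨_, hgrad⟩, hgrad, hG⟩
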